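/- Let $k\ge 1$ and let $\alpha_1,\alpha_2,\alpha_3$ be integers. Put $q=e^{2\pi i/k}$ and let $\omega=\frac1k(\alpha_1,\alpha_2,\alpha_3)$ be the linear map $(z_1,z_2,z_3)\mapsto(q^{\alpha_1}z_1,q^{\alpha_2}z_2,q^{\alpha_3}z_3)$ of $\mathbb C^3$. Assume that $\omega\in SU(3)$ and that $\omega$ has order exactly $k$, and let $\mathbb Z_k=\langle\omega\rangle\subset SU(3)$. Regard $\mathbb C^3/\mathbb Z_k$ as the affine variety with coordinate ring $\mathbb C[z_1,z_2,z_3]^{\mathbb Z_k}$; its points are the $\mathbb Z_k$-orbits in $\mathbb C^3$, with the quotient topology. A point is singular if its local ring is not a regular local ring, and a singular point is isolated if it has an open neighbourhood containing no other singular point. Then: 1. Every singular point of $\mathbb C^3/\mathbb Z_k$ is isolated if and only if $\gcd(k,\alpha_i)=1$ for $i=1,2,3$. 2. If $k\ge 2$, then the image of the origin is the one and only singular point of $\mathbb C^3/\mathbb Z_k$ if and only if $\gcd(k,\alpha_i)=1$ for $i=1,2,3$. 3. If $k$ is even, then $\mathbb C^3/\mathbb Z_k$ has non-isolated singularities. More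 precisely, for some $i$ the integer $\alpha_i$ is even, some non-trivial element of $\mathbb Z_k$ fixes every point of the $z_i$-axis, and the image in $\mathbb C^3/\mathbb Z_k$ of every point of the $z_i$-axis is a non-isolated singular point. -/

import Mathlib

/-- The group `SU(3)`. -/
abbrev SU3 : Type := Matrix.specialUnitaryGroup (Fin 3) ℂ

/-- The matrix of the transformation `(1/k)(α₁, α₂, α₃)` of `ℂ³`, that is
`(z₁, z₂, z₃) ↦ (q ^ α₁ z₁, q ^ α₂ z₂, q ^ α₃ z₃)` with `q = exp (2 π i / k)`. -/
noncomputable def diagonalWeight (k : ℕ) (α : Fin 3 → ℤ) : Matrix (Fin 3) (Fin 3) ℂ :=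
  Matrix.diagonal fun i => Complex.exp (2 * Real.pi * Complex.I / k) ^ α i

/-- Two points of `ℂ³` are equivalent when some element of `Γ` maps one to the other. -/
def orbitSetoid (Γ : Subgroup SU3) : Setoid (Fin 3 → ℂ) where
  r z w := ∃ γ ∈ Γ, (γ : Matrix (Fin 3) (Fin 3) ℂ).mulVec z = w
  iseqv :=
    { refl := fun z => ⟨1, Γ.one_mem, by simp⟩
      symm := by
        rintro z w ⟨γ, hγ, rfl⟩
        refine ⟨γ⁻¹, Γ.inv_mem hγ, ?_⟩
        rw [Matrix.mulVec_mulVec, ← Submonoid.coe_mul, inv_mul_cancel, Submonoid.coe_one,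
          Matrix.one_mulVec]
      trans := by
        rintro z w v ⟨γ, hγ, rfl⟩ ⟨δ, hδ, rfl⟩
        exact ⟨δ * γ, Γ.mul_mem hδ hγ, by rw [Submonoid.coe_mul, Matrix.mulVec_mulVec]⟩ }

/-- The orbit space `ℂ³ / Γ`. -/
def Orbifold (Γ : Subgroup SU3) : Type := Quotient (orbitSetoid Γ)

/-- The quotient topology on `ℂ³ / Γ` coming from the usual topology of `ℂ³`. -/
instance (Γ : Subgroup SU3) : TopologicalSpace (Orbifold Γ) :=
  inferInstanceAs (TopologicalSpace (Quotient (orbitSetoid Γ)))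

/-- The point of `ℂ³ / Γ` represented by `z`. -/
def Orbifold.mk (Γ : Subgroup SU3) (z : Fin 3 → ℂ) : Orbifold Γ := Quotient.mk (orbitSetoid Γ) z

/-- The ring `ℂ[z₁, z₂, z₃] ^ Γ` of `Γ`-invariant polynomials: the coordinate ring of the affine
variety `ℂ³ / Γ`. -/
def invariantRing (Γ : Subgroup SU3) : Subalgebra ℂ (MvPolynomial (Fin 3) ℂ) where
  carrier := {f | ∀ γ ∈ Γ, ∀ z : Fin 3 → ℂ,
    MvPolynomial.eval ((γ : Matrix (Fin 3) (Fin 3) ℂ).mulVec z) f = MvPolynomial.eval z f}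
  mul_mem' := by
    intro f g hf hg γ hγ z
    rw [map_mul, map_mul, hf γ hγ z, hg γ hγ z]
  add_mem' := by
    intro f g hf hg γ hγ z
    rw [map_add, map_add, hf γ hγ z, hg γ hγ z]
  algebraMap_mem' := by
    intro c γ _ z
    simp [MvPolynomial.algebraMap_eq]

/-- The evaluation of invariant polynomials at a point of `ℂ³ / Γ`. -/
noncomputable def Orbifold.evalHom {Γ : Subgroup SU3} (p : Orbifold Γ) :
    invariantRing Γ →+* ℂ :=
  Quotient.lift (s := orbitSetoid Γ)
    (fun z => (MvPolynomial.eval z).comp (invariantRing Γ).val.toRingHom)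
    (by
      rintro z w ⟨γ, hγ, rfl⟩
      ext f
      exact (f.2 γ hγ z).symm) p

/-- The maximal ideal of the invariant polynomials vanishing at a point of `ℂ³ / Γ`. -/
noncomputable def Orbifold.pointIdeal {Γ : Subgroup SU3} (p : Orbifold Γ) :
    Ideal (invariantRing Γ) :=
  RingHom.ker p.evalHom

instance {Γ : Subgroup SU3} (p : Orbifold Γ) : p.pointIdeal.IsPrime :=
  RingHom.ker_isPrime p.evalHom

/-- The point `p` of `ℂ³ / Γ` is singular if the local ring of the variety `ℂ³ / Γ` at `p` is not
a regular local ring. -/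
def Orbifold.IsSingular {Γ : Subgroup SU3} (p : Orbifold Γ) : Prop :=
  ¬ IsRegularLocalRing (Localization.AtPrime p.pointIdeal)

/-- The point `p` is an isolated singularity: `p` is singular, and some open neighbourhood of `p`
contains no other singular point. -/
def Orbifold.IsIsolatedSingularity {Γ : Subgroup SU3} (p : Orbifold Γ) : Prop :=
  p.IsSingular ∧ ∃ U : Set (Orbifold Γ), IsOpen U ∧ p ∈ U ∧ ∀ q ∈ U, q.IsSingular → q = p

/-- Every singular point of `ℂ³ / Γ` is an isolated singularity. -/
def HasOnlyIsolatedSingularities (Γ : Subgroup SU3) : Prop :=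
  ∀ p : Orbifold Γ, p.IsSingular → p.IsIsolatedSingularity

/-! Everything rests on one criterion (`isSingular_iff_exists_stabilizer`): the image of z is
singular exactly when z has a non-trivial stabilizer. Every local ring has dimension 3, because the
polynomial ring is integral over the invariants (`height_pointIdeal`), so the question is whether
three elements generate its maximal ideal.

If the stabilizer is trivial, there are invariants agreeing with the local coordinates to first
order at z; Nakayama, then averaging over the group, shows that they generate. Otherwise, invariants
expand at z in monomials fixed by the stabilizer. A diagonal matrix of determinant 1 other than the
identity moves at least two coordinates (there are no pseudoreflections). So, besides a pure power
of each coordinate, the product of the moved coordinates is an indecomposable invariant monomial,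
and these four give independent functionals on the cotangent space.

The rest is arithmetic: ω^j fixes a vector with z_i ≠ 0 only if k ∣ j α_i. Coprime weights leave
only the origin, while d = gcd(k, α_i) > 1 makes ω^(k/d) fix the whole z_i-axis. Determinant 1 gives
k ∣ α₁ + α₂ + α₃, so an even k forces an even weight. -/

/-! ### Linear substitutions and invariance -/

open MvPolynomial in
/-- The substitution `f ↦ f ∘ M` on polynomials in three variables. -/
noncomputable def linearSubst (M : Matrix (Fin 3) (Fin 3) ℂ) :
    MvPolynomial (Fin 3) ℂ →ₐ[ℂ] MvPolynomial (Fin 3) ℂ :=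
  aeval fun i => ∑ j, C (M i j) * X j

lemma eval_linearSubst (M : Matrix (Fin 3) (Fin 3) ℂ) (z : Fin 3 → ℂ)
    (f : MvPolynomial (Fin 3) ℂ) :
    MvPolynomial.eval z (linearSubst M f) = MvPolynomial.eval (M.mulVec z) f := by
  induction f using MvPolynomial.induction_on with
  | C a => simp [linearSubst]
  | add p q hp hq => simp [hp, hq]
  | mul_X p i hp =>
    simp only [map_mul, hp]
    simp [linearSubst, Matrix.mulVec, dotProduct]

/-- Substitution is contravariant, hence the reversed product. -/
lemma linearSubst_mul (M N : Matrix (Fin 3) (Fin 3) ℂ) (f : MvPolynomial (Fin 3) ℂ) :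
    linearSubst M (linearSubst N f) = linearSubst (N * M) f := by
  apply MvPolynomial.funext
  intro z
  simp [eval_linearSubst]

lemma mem_invariantRing_iff {Γ : Subgroup SU3} {f : MvPolynomial (Fin 3) ℂ} :
    f ∈ invariantRing Γ ↔
      ∀ γ ∈ Γ, linearSubst (γ : Matrix (Fin 3) (Fin 3) ℂ) f = f := by
  constructor
  · intro h γ hγ
    apply MvPolynomial.funext
    intro z
    rw [eval_linearSubst]
    exact h γ hγ z
  · intro h γ hγ z
    rw [← eval_linearSubst, h γ hγ]

/-- The sum of the translates of a polynomial under a finite group. -/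
noncomputable def orbitSum (Γ : Subgroup SU3) [Fintype Γ] :
    MvPolynomial (Fin 3) ℂ →ₗ[ℂ] MvPolynomial (Fin 3) ℂ :=
  ∑ γ : Γ, (linearSubst (γ : Matrix (Fin 3) (Fin 3) ℂ)).toLinearMap

/-! ### Averaging over the group -/

section OrbitSum

variable (Γ : Subgroup SU3) [Fintype Γ]

lemma orbitSum_apply (f : MvPolynomial (Fin 3) ℂ) :
    orbitSum Γ f = ∑ γ : Γ, linearSubst (γ : Matrix (Fin 3) (Fin 3) ℂ) f := by
  simp [orbitSum]

lemma orbitSum_mem (f : MvPolynomial (Fin 3) ℂ) : orbitSum Γ f ∈ invariantRing Γ := by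
  rw [mem_invariantRing_iff]
  intro γ hγ
  rw [orbitSum_apply, map_sum]
  simp only [linearSubst_mul]
  exact Fintype.sum_equiv (Equiv.mulRight (⟨γ, hγ⟩ : Γ)) _ _ (fun δ => by simp)

/-- Linearity over the invariants lets averaging carry relations between invariants from the
polynomial ring down to the invariant ring. -/
lemma orbitSum_mul {a : MvPolynomial (Fin 3) ℂ} (ha : a ∈ invariantRing Γ)
    (f : MvPolynomial (Fin 3) ℂ) : orbitSum Γ (a * f) = a * orbitSum Γ f := by
  rw [orbitSum_apply, orbitSum_apply, Finset.mul_sum]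
  refine Finset.sum_congr rfl fun γ _ => ?_
  rw [map_mul, mem_invariantRing_iff.mp ha γ γ.2]

end OrbitSum

/-! ### Maximal ideals of points and prescribed jets -/

/-- The maximal ideal of polynomials vanishing at a point. -/
noncomputable def vanishingAt (z : Fin 3 → ℂ) : Ideal (MvPolynomial (Fin 3) ℂ) :=
  RingHom.ker (MvPolynomial.eval z)

lemma mem_vanishingAt {z : Fin 3 → ℂ} {f : MvPolynomial (Fin 3) ℂ} :
    f ∈ vanishingAt z ↔ MvPolynomial.eval z f = 0 := Iff.rfl

instance (z : Fin 3 → ℂ) : (vanishingAt z).IsMaximal :=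
  RingHom.ker_isMaximal_of_surjective _ fun c => ⟨MvPolynomial.C c, by simp⟩

lemma vanishingAt_eq_span (z : Fin 3 → ℂ) :
    vanishingAt z = Ideal.span (Set.range fun i => MvPolynomial.X i - MvPolynomial.C (z i)) := by
  apply le_antisymm
  · intro f hf
    have key : ∀ g : MvPolynomial (Fin 3) ℂ, g - MvPolynomial.C (MvPolynomial.eval z g) ∈
        Ideal.span (Set.range fun i => MvPolynomial.X i - MvPolynomial.C (z i)) := by
      intro g
      induction g using MvPolynomial.induction_on with
      | C a => simp
      | add p q hp hq =>
        convert Ideal.add_mem _ hp hq using 1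
        simp only [map_add]
        ring
      | mul_X p i hp =>
        have hX : (MvPolynomial.X i - MvPolynomial.C (z i) : MvPolynomial (Fin 3) ℂ) ∈
            Ideal.span (Set.range fun i => MvPolynomial.X i - MvPolynomial.C (z i)) :=
          Ideal.subset_span ⟨i, rfl⟩
        convert Ideal.add_mem _ (Ideal.mul_mem_left _ (MvPolynomial.X i) hp)
          (Ideal.mul_mem_left _ (MvPolynomial.C (MvPolynomial.eval z p)) hX) using 1
        simp only [map_mul, MvPolynomial.eval_X]
        ring
    simpa [mem_vanishingAt.mp hf] using key f
  · rw [Ideal.span_le]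
    rintro _ ⟨i, rfl⟩
    simp [mem_vanishingAt]

lemma vanishingAt_injective : Function.Injective vanishingAt := by
  intro z w h
  funext i
  have : (MvPolynomial.X i - MvPolynomial.C (z i) : MvPolynomial (Fin 3) ℂ) ∈ vanishingAt w := by
    rw [← h]
    simp [mem_vanishingAt]
  simpa [mem_vanishingAt, sub_eq_zero, eq_comm] using this

/-- Chinese remainder theorem: distinct maximal ideals are comaximal, and so are their powers. -/
lemma exists_sub_one_mem_vanishingAt_pow (z : Fin 3 → ℂ) (s : Finset (Fin 3 → ℂ)) (hz : z ∉ s)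
    (N : ℕ) :
    ∃ h : MvPolynomial (Fin 3) ℂ, h - 1 ∈ vanishingAt z ^ N ∧ ∀ w ∈ s, h ∈ vanishingAt w ^ N := by
  have hc : IsCoprime (vanishingAt z ^ N) (∏ w ∈ s, vanishingAt w ^ N) := by
    refine IsCoprime.prod_right fun w hw => IsCoprime.pow ?_
    rw [Ideal.isCoprime_iff_sup_eq]
    refine Ideal.IsMaximal.coprime_of_ne inferInstance inferInstance fun h => hz ?_
    rwa [vanishingAt_injective h]
  obtain ⟨a, ha, b, hb, hab⟩ := Ideal.isCoprime_iff_exists.mp hc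
  refine ⟨b, ?_, fun w hw => ?_⟩
  · rw [← hab]
    simpa using ha
  · exact (Ideal.prod_le_inf.trans (Finset.inf_le hw)) hb

lemma linearSubst_mem_vanishingAt_pow (M : Matrix (Fin 3) (Fin 3) ℂ) (z : Fin 3 → ℂ) (N : ℕ)
    {f : MvPolynomial (Fin 3) ℂ} (hf : f ∈ vanishingAt (M.mulVec z) ^ N) :
    linearSubst M f ∈ vanishingAt z ^ N := by
  have h : Ideal.map (linearSubst M) (vanishingAt (M.mulVec z)) ≤ vanishingAt z := by
    rw [Ideal.map_le_iff_le_comap]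
    intro g hg
    rw [Ideal.mem_comap, mem_vanishingAt, eval_linearSubst]
    exact hg
  have h2 := Ideal.mem_map_of_mem (linearSubst M) hf
  rw [Ideal.map_pow] at h2
  exact Ideal.pow_right_mono h N h2

/-- A polynomial invariant under the stabilizer of `z` agrees to any given order at `z` with an
invariant polynomial. -/
lemma exists_invariant_sub_mem (Γ : Subgroup SU3) [Finite Γ] (z : Fin 3 → ℂ) (N : ℕ)
    (P : MvPolynomial (Fin 3) ℂ)
    (hP : ∀ γ ∈ Γ, (γ : Matrix (Fin 3) (Fin 3) ℂ).mulVec z = z →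
      linearSubst (γ : Matrix (Fin 3) (Fin 3) ℂ) P = P) :
    ∃ F ∈ invariantRing Γ, F - P ∈ vanishingAt z ^ N := by
  classical
  have := Fintype.ofFinite Γ
  let s : Finset (Fin 3 → ℂ) :=
    (Finset.univ.image fun γ : Γ => (γ : Matrix (Fin 3) (Fin 3) ℂ).mulVec z).erase z
  -- Modulo order N at z, averaging h * P kills the terms outside the stabilizer and turns each term
  -- inside it into P, so the result is P times the order of the stabilizer.
  obtain ⟨h, h1, h2⟩ := exists_sub_one_mem_vanishingAt_pow z s (by simp [s]) N
  let H : Finset Γ := Finset.univ.filter fun γ : Γ =>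
    (γ : Matrix (Fin 3) (Fin 3) ℂ).mulVec z = z
  have hH : (H.card : ℂ) ≠ 0 := by
    have : (1 : Γ) ∈ H := by simp [H]
    exact_mod_cast (Finset.card_pos.mpr ⟨_, this⟩).ne'
  have key : orbitSum Γ (h * P) - (H.card : ℂ) • P ∈ vanishingAt z ^ N := by
    have : orbitSum Γ (h * P) - (H.card : ℂ) • P = ∑ γ : Γ,
        (linearSubst (γ : Matrix (Fin 3) (Fin 3) ℂ) (h * P) - if γ ∈ H then P else 0) := by
      rw [Finset.sum_sub_distrib, ← orbitSum_apply, Finset.sum_ite_mem]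
      simp [Nat.cast_smul_eq_nsmul]
    rw [this]
    refine Ideal.sum_mem _ fun γ _ => ?_
    by_cases hγ : (γ : Matrix (Fin 3) (Fin 3) ℂ).mulVec z = z
    · have hm : γ ∈ H := by simp [H, hγ]
      rw [if_pos hm, map_mul, hP γ γ.2 hγ]
      have : linearSubst (γ : Matrix (Fin 3) (Fin 3) ℂ) (h - 1) ∈ vanishingAt z ^ N :=
        linearSubst_mem_vanishingAt_pow _ _ _ (by rwa [hγ])
      convert Ideal.mul_mem_right P _ this using 1
      rw [map_sub, map_one]
      ring
    · have hm : γ ∉ H := by simp [H, hγ]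
      rw [if_neg hm, sub_zero, map_mul]
      refine Ideal.mul_mem_right _ _ (linearSubst_mem_vanishingAt_pow _ _ _ (h2 _ ?_))
      simp only [s, Finset.mem_erase, Finset.mem_image, Finset.mem_univ, true_and]
      exact ⟨hγ, γ, rfl⟩
  refine ⟨(H.card : ℂ)⁻¹ • orbitSum Γ (h * P),
    (invariantRing Γ).smul_mem (orbitSum_mem Γ _) _, ?_⟩
  have := (vanishingAt z ^ N).smul_of_tower_mem (H.card : ℂ)⁻¹ key
  rwa [smul_sub, smul_smul, inv_mul_cancel₀ hH, one_smul] at this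

/-! ### Points of the quotient and their ideals -/

section PointIdeal

variable {Γ : Subgroup SU3}

lemma mem_pointIdeal_mk {z : Fin 3 → ℂ} {f : invariantRing Γ} :
    f ∈ (Orbifold.mk Γ z).pointIdeal ↔ MvPolynomial.eval z (f : MvPolynomial (Fin 3) ℂ) = 0 :=
  Iff.rfl

lemma comap_vanishingAt (z : Fin 3 → ℂ) :
    (vanishingAt z).comap (algebraMap (invariantRing Γ) (MvPolynomial (Fin 3) ℂ)) =
      (Orbifold.mk Γ z).pointIdeal := rfl

lemma Orbifold.mk_eq_mk_iff {z w : Fin 3 → ℂ} :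
    Orbifold.mk Γ z = Orbifold.mk Γ w ↔
      ∃ γ ∈ Γ, (γ : Matrix (Fin 3) (Fin 3) ℂ).mulVec z = w :=
  Quotient.eq (r := orbitSetoid Γ)

end PointIdeal

/-! ### Integrality and local dimension -/

section Height

variable {Γ : Subgroup SU3} {n : ℕ}

lemma isIntegral_of_pow_mem (hn : 0 < n)
    (hX : ∀ i, (MvPolynomial.X i : MvPolynomial (Fin 3) ℂ) ^ n ∈ invariantRing Γ) :
    Algebra.IsIntegral (invariantRing Γ) (MvPolynomial (Fin 3) ℂ) := by
  refine ⟨fun f => ?_⟩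
  induction f using MvPolynomial.induction_on with
  | C a => exact isIntegral_algebraMap (R := invariantRing Γ) (x := algebraMap ℂ _ a)
  | add p q hp hq => exact hp.add hq
  | mul_X p i hp =>
    refine hp.mul (IsIntegral.of_pow hn ?_)
    exact isIntegral_algebraMap (R := invariantRing Γ) (x := ⟨_, hX i⟩)

/-- Artin–Tate: the polynomial ring is finite over the invariants, so these form a finitely
generated ℂ-algebra. -/
lemma isNoetherianRing_of_pow_mem (hn : 0 < n)
    (hX : ∀ i, (MvPolynomial.X i : MvPolynomial (Fin 3) ℂ) ^ n ∈ invariantRing Γ) :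
    IsNoetherianRing (invariantRing Γ) := by
  have := isIntegral_of_pow_mem hn hX
  have hft : Algebra.FiniteType (invariantRing Γ) (MvPolynomial (Fin 3) ℂ) :=
    Algebra.FiniteType.of_restrictScalars_finiteType ℂ _ _
  have hfin : Module.Finite (invariantRing Γ) (MvPolynomial (Fin 3) ℂ) :=
    Algebra.IsIntegral.finite
  have hfg : (⊤ : Subalgebra ℂ (invariantRing Γ)).FG :=
    fg_of_fg_of_fg ℂ (invariantRing Γ) (MvPolynomial (Fin 3) ℂ)
      (Algebra.FiniteType.out) Module.Finite.fg_top Subtype.val_injective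
  have : Algebra.FiniteType ℂ (invariantRing Γ) := ⟨hfg⟩
  exact Algebra.FiniteType.isNoetherianRing ℂ _

/-- Some maximal ideal attains the dimension 3; by the Nullstellensatz it belongs to a point, and
translations carry that point to any other. -/
lemma height_vanishingAt (z : Fin 3 → ℂ) : (vanishingAt z).height = 3 := by
  have hdim : ringKrullDim (MvPolynomial (Fin 3) ℂ) = 3 := by
    rw [MvPolynomial.ringKrullDim_of_isNoetherianRing, ringKrullDim_eq_zero_of_field]
    simp
  have : FiniteRingKrullDim (MvPolynomial (Fin 3) ℂ) := by
    rw [finiteRingKrullDim_iff_ne_bot_and_top, hdim]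
    exact ⟨by decide, by decide⟩
  obtain ⟨m, hm, hh⟩ := Ideal.exists_isMaximal_height (R := MvPolynomial (Fin 3) ℂ)
  obtain ⟨w, hw⟩ := MvPolynomial.isMaximal_iff_eq_vanishingIdeal_singleton.mp hm
  have hmw : m = vanishingAt w := by
    ext f
    rw [hw, MvPolynomial.mem_vanishingIdeal_singleton_iff, mem_vanishingAt]
    rfl
  let e : MvPolynomial (Fin 3) ℂ ≃+* MvPolynomial (Fin 3) ℂ :=
    RingEquiv.ofRingHom
      (MvPolynomial.aeval fun i => MvPolynomial.X i + MvPolynomial.C (z i - w i) :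
        MvPolynomial (Fin 3) ℂ →ₐ[ℂ] MvPolynomial (Fin 3) ℂ).toRingHom
      (MvPolynomial.aeval fun i => MvPolynomial.X i - MvPolynomial.C (z i - w i) :
        MvPolynomial (Fin 3) ℂ →ₐ[ℂ] MvPolynomial (Fin 3) ℂ).toRingHom
      (by ext i <;> simp) (by ext i <;> simp)
  have he : (vanishingAt w).comap e = vanishingAt z := by
    ext f
    rw [Ideal.mem_comap, mem_vanishingAt, mem_vanishingAt]
    have : (MvPolynomial.eval w).comp (e : MvPolynomial (Fin 3) ℂ →+* MvPolynomial (Fin 3) ℂ) =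
        MvPolynomial.eval z := by
      ext i <;> simp [e]
    rw [← this]
    rfl
  rw [← he, RingEquiv.height_comap, ← hmw]
  rw [hdim] at hh
  exact WithBot.coe_injective hh

/-- Krull's height theorem, applied to the three invariants X_i^n - z_i^n, bounds the height above.
Contraction along an integral extension is strictly monotone on primes, which bounds it below. -/
lemma height_pointIdeal (hn : 0 < n)
    (hX : ∀ i, (MvPolynomial.X i : MvPolynomial (Fin 3) ℂ) ^ n ∈ invariantRing Γ)
    (z : Fin 3 → ℂ) : (Orbifold.mk Γ z).pointIdeal.height = 3 := by
  have hint := isIntegral_of_pow_mem hn hX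
  have hnoeth := isNoetherianRing_of_pow_mem hn hX
  apply le_antisymm
  · let F : Fin 3 → invariantRing Γ := fun i =>
      ⟨MvPolynomial.X i ^ n, hX i⟩ - algebraMap ℂ _ (z i ^ n)
    have hF : ∀ i, (F i : MvPolynomial (Fin 3) ℂ) =
        MvPolynomial.X i ^ n - MvPolynomial.C (z i ^ n) := fun i => rfl
    have hmin : (Orbifold.mk Γ z).pointIdeal ∈ (Ideal.span (Set.range F)).minimalPrimes := by
      refine ⟨⟨inferInstance, ?_⟩, ?_⟩
      · rw [Ideal.span_le]
        rintro _ ⟨i, rfl⟩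
        rw [SetLike.mem_coe, mem_pointIdeal_mk, hF]
        simp
      · rintro P ⟨hP, hle⟩ hPle
        -- A prime lying over P contains a linear factor of each X_i^n - z_i^n, hence is the ideal
        -- of a point w.
        obtain ⟨Q', -, hQ', hQP⟩ := Ideal.exists_ideal_over_prime_of_isIntegral
          (S := MvPolynomial (Fin 3) ℂ) P ⊥ (by simp)
        have hroot : ∀ i, ∃ w : ℂ, (MvPolynomial.X i - MvPolynomial.C w) ∈ Q' := by
          intro i
          have hmem : (MvPolynomial.X i ^ n - MvPolynomial.C (z i ^ n) :
              MvPolynomial (Fin 3) ℂ) ∈ Q' := by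
            have : F i ∈ Q'.comap (algebraMap (invariantRing Γ) (MvPolynomial (Fin 3) ℂ)) := by
              rw [hQP]
              exact hle (Ideal.subset_span ⟨i, rfl⟩)
            exact this
          have hfac : (MvPolynomial.X i ^ n - MvPolynomial.C (z i ^ n) :
              MvPolynomial (Fin 3) ℂ) = ((Polynomial.X ^ n - Polynomial.C (z i ^ n) :
                Polynomial ℂ).roots.map
                  fun w => MvPolynomial.X i - MvPolynomial.C w).prod := by
            have hs := (IsAlgClosed.splits
              (Polynomial.X ^ n - Polynomial.C (z i ^ n) : Polynomial ℂ)).eq_prod_roots_of_monic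
                (Polynomial.monic_X_pow_sub_C _ hn.ne')
            have := congrArg (Polynomial.aeval (MvPolynomial.X i : MvPolynomial (Fin 3) ℂ)) hs
            rw [map_multiset_prod, Multiset.map_map] at this
            simpa [MvPolynomial.algebraMap_eq, Function.comp_def] using this
          rw [hfac] at hmem
          obtain ⟨g, hg, hgQ⟩ := (Ideal.IsPrime.multiset_prod_mem_iff_exists_mem hQ' _).mp hmem
          obtain ⟨w, -, rfl⟩ := Multiset.mem_map.mp hg
          exact ⟨w, hgQ⟩
        choose w hw using hroot
        have hQw : Q' = vanishingAt w := by
          refine ((inferInstance : (vanishingAt w).IsMaximal).eq_of_le hQ'.ne_top ?_).symm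
          rw [vanishingAt_eq_span, Ideal.span_le]
          rintro _ ⟨i, rfl⟩
          exact hw i
        intro f hf
        -- Since P lies in the ideal of z, this element vanishes at z as well, which forces f(w) =
        -- f(z) = 0.
        have hsub : f - algebraMap ℂ _ (MvPolynomial.eval w (f : MvPolynomial (Fin 3) ℂ)) ∈ P := by
          rw [← hQP, hQw, comap_vanishingAt, mem_pointIdeal_mk]
          simp [MvPolynomial.algebraMap_eq]
        have h0 : MvPolynomial.eval w (f : MvPolynomial (Fin 3) ℂ) = 0 := by
          have h1 := hPle hsub
          rw [mem_pointIdeal_mk] at h1 hf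
          simpa [hf, MvPolynomial.algebraMap_eq] using h1
        simpa [h0] using hsub
    have := Ideal.height_le_card_of_mem_minimalPrimes_span (Set.finite_range F) hmin
    refine this.trans ?_
    have h3 : (Set.range F).ncard ≤ 3 := by
      rw [← Set.image_univ]
      refine (Set.ncard_image_le Set.finite_univ).trans ?_
      simp [Set.ncard_univ]
    exact_mod_cast h3
  · rw [← height_vanishingAt z]
    have hmono : StrictMono (PrimeSpectrum.comap
        (algebraMap (invariantRing Γ) (MvPolynomial (Fin 3) ℂ))) := by
      intro I J hIJ
      exact Ideal.IsIntegral.comap_lt_comap hIJ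
    have := Order.height_le_height_apply_of_strictMono _ hmono
      ⟨vanishingAt z, inferInstance⟩
    rw [← PrimeSpectrum.height_eq_orderHeight, ← PrimeSpectrum.height_eq_orderHeight] at this
    exact this

end Height

/-! ### Generators of the maximal ideal of a localization -/

section Localization

variable {A : Type*} [CommRing A] (p : Ideal A) [p.IsPrime]

lemma maximalIdeal_eq_span_of_forall_exists_mul_mem (s : Set A) (hs : s ⊆ p)
    (h : ∀ f ∈ p, ∃ S ∉ p, S * f ∈ Ideal.span s) :
    IsLocalRing.maximalIdeal (Localization.AtPrime p) =
      Ideal.span (algebraMap A (Localization.AtPrime p) '' s) := by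
  rw [← Localization.AtPrime.map_eq_maximalIdeal, ← Ideal.map_span]
  apply le_antisymm
  · rw [Ideal.map_le_iff_le_comap]
    intro f hf
    obtain ⟨S, hS, hSf⟩ := h f hf
    have h1 := Ideal.mem_map_of_mem (algebraMap A (Localization.AtPrime p)) hSf
    rw [map_mul] at h1
    exact (Ideal.unit_mul_mem_iff_mem _
      (IsLocalization.map_units (Localization.AtPrime p) (⟨S, hS⟩ : p.primeCompl))).mp h1
  · exact Ideal.map_mono (Ideal.span_le.mpr hs)

lemma exists_generators_of_maximalIdeal_spanFinrank [IsNoetherianRing A] :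
    ∃ s : Finset A, s.card ≤ (IsLocalRing.maximalIdeal (Localization.AtPrime p)).spanFinrank ∧
      (s : Set A) ⊆ p ∧ ∀ f ∈ p, ∃ S ∉ p, S * f ∈ Ideal.span (s : Set A) := by
  classical
  obtain ⟨t, ht, hspan⟩ := Submodule.FG.exists_span_finset_card_eq_spanFinrank
    (IsNoetherian.noetherian (IsLocalRing.maximalIdeal (Localization.AtPrime p)))
  have hnum : ∀ x : Localization.AtPrime p, ∃ a : A, ∃ S ∉ p,
      x * algebraMap A _ S = algebraMap A _ a := by
    intro x
    obtain ⟨⟨a, S⟩, h⟩ := IsLocalization.surj p.primeCompl x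
    exact ⟨a, S, S.2, h⟩
  choose num den hden hmul using hnum
  have hunit : ∀ S ∉ p, IsUnit (algebraMap A (Localization.AtPrime p) S) := fun S hS =>
    IsLocalization.map_units (Localization.AtPrime p) (⟨S, hS⟩ : p.primeCompl)
  -- Each generator differs from its numerator by a unit.
  have hmap : Ideal.map (algebraMap A (Localization.AtPrime p)) (Ideal.span (num '' t)) =
      IsLocalRing.maximalIdeal (Localization.AtPrime p) := by
    rw [Ideal.map_span, ← hspan, Set.image_image]
    apply le_antisymm
    · refine Ideal.span_le.mpr ?_
      rintro _ ⟨x, hx, rfl⟩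
      change algebraMap A _ (num x) ∈ Ideal.span (t : Set (Localization.AtPrime p))
      rw [← hmul]
      exact Ideal.mul_mem_right _ _ (Ideal.subset_span hx)
    · refine Ideal.span_le.mpr fun x hx => ?_
      refine (Ideal.mul_unit_mem_iff_mem _ (hunit _ (hden x))).mp ?_
      rw [hmul]
      exact Ideal.subset_span ⟨x, hx, rfl⟩
  refine ⟨t.image num, Finset.card_image_le.trans ht.le, ?_, ?_⟩
  · rw [Finset.coe_image]
    intro a ha
    have h1 := Ideal.mem_map_of_mem (algebraMap A (Localization.AtPrime p))
      (Ideal.subset_span (α := A) ha)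
    rw [hmap] at h1
    exact (IsLocalization.AtPrime.to_map_mem_maximal_iff _ p a).mp h1
  · intro f hf
    have h1 : algebraMap A (Localization.AtPrime p) f ∈
        Ideal.map (algebraMap A (Localization.AtPrime p)) (Ideal.span (num '' t)) := by
      rw [hmap]
      exact (IsLocalization.AtPrime.to_map_mem_maximal_iff _ p f).mpr hf
    obtain ⟨S, hS, h2⟩ := (IsLocalization.algebraMap_mem_map_algebraMap_iff p.primeCompl _ _ _).mp h1
    exact ⟨S, hS, by rwa [Finset.coe_image]⟩

end Localization

/-! ### Trivial stabilizer: regular points -/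

section Regular

variable {Γ : Subgroup SU3} {n : ℕ}

/-- A point with trivial stabilizer is regular. -/
theorem not_isSingular_of_stabilizer_trivial [Finite Γ] (hn : 0 < n)
    (hX : ∀ i, (MvPolynomial.X i : MvPolynomial (Fin 3) ℂ) ^ n ∈ invariantRing Γ)
    (z : Fin 3 → ℂ)
    (hz : ∀ γ ∈ Γ, (γ : Matrix (Fin 3) (Fin 3) ℂ).mulVec z = z → γ = 1) :
    ¬ (Orbifold.mk Γ z).IsSingular := by
  classical
  have := Fintype.ofFinite Γ
  have := isNoetherianRing_of_pow_mem hn hX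
  rw [Orbifold.IsSingular, not_not]
  have hlin : ∀ P : MvPolynomial (Fin 3) ℂ, ∀ γ ∈ Γ,
      (γ : Matrix (Fin 3) (Fin 3) ℂ).mulVec z = z →
        linearSubst (γ : Matrix (Fin 3) (Fin 3) ℂ) P = P := by
    intro P γ hγ h
    rw [hz γ hγ h]
    apply MvPolynomial.funext
    intro w
    simp [eval_linearSubst]
  choose F hFmem hF using fun i : Fin 3 =>
    exists_invariant_sub_mem Γ z 2 (MvPolynomial.X i - MvPolynomial.C (z i)) (hlin _)
  -- The cutoff h keeps the averaged denominator `orbitSum Γ (h * s)` from vanishing at z.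
  obtain ⟨h, hhmem, hh⟩ : ∃ h : MvPolynomial (Fin 3) ℂ, MvPolynomial.eval z h = 1 ∧
      ∀ γ : Γ, γ ≠ 1 → MvPolynomial.eval ((γ : Matrix (Fin 3) (Fin 3) ℂ).mulVec z) h = 0 := by
    let s : Finset (Fin 3 → ℂ) :=
      (Finset.univ.image fun γ : Γ => (γ : Matrix (Fin 3) (Fin 3) ℂ).mulVec z).erase z
    obtain ⟨h, h1, h2⟩ := exists_sub_one_mem_vanishingAt_pow z s (by simp [s]) 1
    refine ⟨h, ?_, fun γ hγ => ?_⟩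
    · rw [pow_one, mem_vanishingAt] at h1
      simpa [sub_eq_zero] using h1
    · have := h2 ((γ : Matrix (Fin 3) (Fin 3) ℂ).mulVec z) ?_
      · rwa [pow_one, mem_vanishingAt] at this
      · simp only [s, Finset.mem_erase, Finset.mem_image, Finset.mem_univ, true_and]
        exact ⟨fun h => hγ (Subtype.ext (hz γ γ.2 h)), γ, rfl⟩
  have hsup : vanishingAt z ≤ Ideal.span (Set.range F) ⊔ vanishingAt z • vanishingAt z := by
    conv_lhs => rw [vanishingAt_eq_span]
    rw [Ideal.span_le]
    rintro _ ⟨i, rfl⟩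
    have h1 : F i ∈ Ideal.span (Set.range F) := Ideal.subset_span ⟨i, rfl⟩
    have h2 := hF i
    rw [pow_two, ← smul_eq_mul] at h2
    have h3 := Submodule.sub_mem_sup h1 h2
    simpa using h3
  -- Nakayama: the F i generate the ideal of z modulo its square, hence after multiplication by some
  -- s with s(z) = 1.
  obtain ⟨s, hs1, hs2⟩ := Submodule.exists_sub_one_mem_and_smul_le_of_fg_of_le_sup
    (IsNoetherian.noetherian (vanishingAt z)) le_rfl hsup
  have hsz : MvPolynomial.eval z s = 1 := by
    rw [mem_vanishingAt] at hs1
    simpa [sub_eq_zero] using hs1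
  let F' : Fin 3 → invariantRing Γ := fun i => ⟨F i, hFmem i⟩
  have hF' : Set.range F' ⊆ (Orbifold.mk Γ z).pointIdeal := by
    rintro _ ⟨i, rfl⟩
    rw [SetLike.mem_coe, mem_pointIdeal_mk]
    have := Ideal.pow_le_self two_ne_zero (hF i)
    rw [mem_vanishingAt] at this
    simpa using this
  have hS : MvPolynomial.eval z (orbitSum Γ (h * s)) = 1 := by
    rw [orbitSum_apply, map_sum, Finset.sum_eq_single 1]
    · simp [eval_linearSubst, hhmem, hsz]
    · intro γ _ hγ
      rw [eval_linearSubst, map_mul, hh γ hγ, zero_mul]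
    · simp
  have hmax := maximalIdeal_eq_span_of_forall_exists_mul_mem (Orbifold.mk Γ z).pointIdeal
    (Set.range F') hF' fun f hf => by
      refine ⟨⟨orbitSum Γ (h * s), orbitSum_mem Γ _⟩, ?_, ?_⟩
      · rw [mem_pointIdeal_mk, hS]
        exact one_ne_zero
      · have hsf : s * (f : MvPolynomial (Fin 3) ℂ) ∈ Ideal.span (Set.range F) :=
          hs2 (Submodule.smul_mem_pointwise_smul _ _ _ hf)
        obtain ⟨r, hr⟩ := Ideal.mem_span_range_iff_exists_fun.mp hsf
        rw [Ideal.mem_span_range_iff_exists_fun]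
        refine ⟨fun i => ⟨orbitSum Γ (h * r i), orbitSum_mem Γ _⟩, Subtype.ext ?_⟩
        -- Average the relation s * f = ∑ r i * F i multiplied by h; the invariants f and F i pass
        -- through the average.
        have : orbitSum Γ (h * s) * (f : MvPolynomial (Fin 3) ℂ) =
            ∑ i, orbitSum Γ (h * r i) * F i := by
          rw [mul_comm, ← orbitSum_mul Γ f.2]
          have : (f : MvPolynomial (Fin 3) ℂ) * (h * s) = ∑ i, F i * (h * r i) := by
            rw [show (f : MvPolynomial (Fin 3) ℂ) * (h * s) = h * (s * f) by ring, ← hr,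
              Finset.mul_sum]
            exact Finset.sum_congr rfl fun i _ => by ring
          rw [this, map_sum]
          exact Finset.sum_congr rfl fun i _ => by rw [orbitSum_mul Γ (hFmem i), mul_comm]
        simpa [F'] using this.symm
  apply IsRegularLocalRing.of_spanFinrank_maximalIdeal_le
  rw [IsLocalization.AtPrime.ringKrullDim_eq_height (Orbifold.mk Γ z).pointIdeal,
    height_pointIdeal hn hX, hmax]
  have hfin := (Set.finite_range F').image
    (algebraMap _ (Localization.AtPrime (Orbifold.mk Γ z).pointIdeal))
  have h3 : (Ideal.span (algebraMap _ (Localization.AtPrime (Orbifold.mk Γ z).pointIdeal) ''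
      Set.range F')).spanFinrank ≤ 3 := by
    refine (Submodule.spanFinrank_span_le_ncard_of_finite hfin).trans
      ((Set.ncard_image_le (Set.finite_range F')).trans ?_)
    rw [← Set.image_univ]
    exact (Set.ncard_image_le Set.finite_univ).trans (by simp [Set.ncard_univ])
  exact_mod_cast h3

end Regular

/-! ### Singularity from the size of the cotangent space -/

section Singular

variable {Γ : Subgroup SU3} {n : ℕ}

/-- A point admitting more than three independent derivations is singular. -/
theorem isSingular_of_derivations (hn : 0 < n)
    (hX : ∀ i, (MvPolynomial.X i : MvPolynomial (Fin 3) ℂ) ^ n ∈ invariantRing Γ)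
    (z : Fin 3 → ℂ) {ι : Type*} [Fintype ι] (hι : 3 < Fintype.card ι)
    (D : invariantRing Γ →ₗ[ℂ] (ι → ℂ))
    (hD : ∀ a, ∀ b ∈ (Orbifold.mk Γ z).pointIdeal,
      D (a * b) = MvPolynomial.eval z (a : MvPolynomial (Fin 3) ℂ) • D b)
    (hsurj : ∀ v, ∃ b ∈ (Orbifold.mk Γ z).pointIdeal, D b = v) :
    (Orbifold.mk Γ z).IsSingular := by
  classical
  intro hreg
  have := isNoetherianRing_of_pow_mem hn hX
  have hrank := hreg.spanFinrank_maximalIdeal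
  rw [IsLocalization.AtPrime.ringKrullDim_eq_height (Orbifold.mk Γ z).pointIdeal,
    height_pointIdeal hn hX] at hrank
  obtain ⟨s, hcard, hsp, hs⟩ :=
    exists_generators_of_maximalIdeal_spanFinrank (Orbifold.mk Γ z).pointIdeal
  have hcard3 : s.card ≤ 3 := by
    refine hcard.trans (le_of_eq ?_)
    exact_mod_cast hrank
  have htop : Submodule.span ℂ ((s.image D : Finset (ι → ℂ)) : Set (ι → ℂ)) = ⊤ := by
    rw [eq_top_iff]
    rintro v -
    obtain ⟨b, hb, rfl⟩ := hsurj v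
    obtain ⟨S, hS, hSb⟩ := hs b hb
    -- D sends the ideal spanned by s into the ℂ-span of the images of at most three generators; as
    -- S(z) ≠ 0, D b lies there too.
    have h1 : ∀ x ∈ Ideal.span (s : Set (invariantRing Γ)),
        D x ∈ Submodule.span ℂ ((s.image D : Finset (ι → ℂ)) : Set (ι → ℂ)) := by
      intro x hx
      obtain ⟨c, -, rfl⟩ := Submodule.mem_span_finset.mp hx
      rw [map_sum]
      refine Submodule.sum_mem _ fun y hy => ?_
      rw [smul_eq_mul, hD _ _ (hsp hy)]
      exact Submodule.smul_mem _ _ (Submodule.subset_span (by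
        rw [Finset.coe_image]
        exact ⟨y, hy, rfl⟩))
    have h2 := h1 _ hSb
    rw [hD _ _ hb] at h2
    exact (Submodule.smul_mem_iff _ (by rwa [mem_pointIdeal_mk] at hS)).mp h2
  have := finrank_span_finset_le_card (R := ℂ) (s.image D)
  rw [Set.finrank, htop, finrank_top, Module.finrank_fintype_fun_eq_card] at this
  have := this.trans (Finset.card_image_le.trans hcard3)
  omega

end Singular

/-! ### Taylor expansion and diagonal substitutions -/

/-- The Taylor expansion of a polynomial at a point. -/
noncomputable def taylorAt (z : Fin 3 → ℂ) :
    MvPolynomial (Fin 3) ℂ →ₐ[ℂ] MvPolynomial (Fin 3) ℂ :=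
  MvPolynomial.aeval fun i => MvPolynomial.X i + MvPolynomial.C (z i)

lemma eval_taylorAt (z w : Fin 3 → ℂ) (f : MvPolynomial (Fin 3) ℂ) :
    MvPolynomial.eval w (taylorAt z f) = MvPolynomial.eval (w + z) f := by
  induction f using MvPolynomial.induction_on with
  | C a => simp [taylorAt]
  | add p q hp hq => simp [hp, hq]
  | mul_X p i hp =>
    simp only [map_mul, hp]
    simp [taylorAt]

lemma taylorAt_taylorAt_neg (z : Fin 3 → ℂ) (f : MvPolynomial (Fin 3) ℂ) :
    taylorAt z (taylorAt (-z) f) = f := by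
  apply MvPolynomial.funext
  intro w
  simp [eval_taylorAt]

lemma coeff_zero_taylorAt (z : Fin 3 → ℂ) (f : MvPolynomial (Fin 3) ℂ) :
    MvPolynomial.coeff 0 (taylorAt z f) = MvPolynomial.eval z f := by
  rw [← MvPolynomial.constantCoeff_eq, ← MvPolynomial.eval_zero, eval_taylorAt, zero_add]

lemma coeff_taylorAt_eq_zero_of_mem_pow {z : Fin 3 → ℂ} {N : ℕ} {f : MvPolynomial (Fin 3) ℂ}
    (hf : f ∈ vanishingAt z ^ N) (e : Fin 3 →₀ ℕ) (he : e.degree < N) :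
    MvPolynomial.coeff e (taylorAt z f) = 0 := by
  have h : Ideal.map (taylorAt z) (vanishingAt z) ≤ MvPolynomial.idealOfVars (Fin 3) ℂ := by
    rw [vanishingAt_eq_span, Ideal.map_span, Ideal.span_le]
    rintro _ ⟨_, ⟨i, rfl⟩, rfl⟩
    have : taylorAt z (MvPolynomial.X i - MvPolynomial.C (z i)) = MvPolynomial.X i := by
      simp [taylorAt]
    rw [SetLike.mem_coe, this]
    exact Ideal.subset_span ⟨i, rfl⟩
  have h2 := Ideal.mem_map_of_mem (taylorAt z) hf
  rw [Ideal.map_pow] at h2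
  exact (MvPolynomial.mem_pow_idealOfVars_iff' N _).mp (Ideal.pow_right_mono h N h2) e he

lemma linearSubst_diagonal_monomial (d : Fin 3 → ℂ) (e : Fin 3 →₀ ℕ) (c : ℂ) :
    linearSubst (Matrix.diagonal d) (MvPolynomial.monomial e c) =
      MvPolynomial.monomial e ((∏ i, d i ^ e i) * c) := by
  apply MvPolynomial.funext
  intro w
  rw [eval_linearSubst, MvPolynomial.eval_monomial, MvPolynomial.eval_monomial,
    Finsupp.prod_fintype _ _ (by simp), Finsupp.prod_fintype _ _ (by simp)]
  simp only [Matrix.mulVec_diagonal, mul_pow, Finset.prod_mul_distrib]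
  ring

lemma coeff_linearSubst_diagonal (d : Fin 3 → ℂ) (f : MvPolynomial (Fin 3) ℂ)
    (e : Fin 3 →₀ ℕ) :
    MvPolynomial.coeff e (linearSubst (Matrix.diagonal d) f) =
      (∏ i, d i ^ e i) * MvPolynomial.coeff e f := by
  classical
  induction f using MvPolynomial.induction_on' with
  | monomial u a =>
    rw [linearSubst_diagonal_monomial, MvPolynomial.coeff_monomial, MvPolynomial.coeff_monomial]
    split_ifs with h
    · rw [h]
    · simp
  | add p q hp hq => rw [map_add, MvPolynomial.coeff_add, MvPolynomial.coeff_add, hp, hq, mul_add]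

/-! ### Invariant monomials of a stabilizer -/

section Diagonal

variable {Γ : Subgroup SU3}

/-- The exponents of the monomials invariant under the stabilizer of a point. -/
def invariantExponents (Γ : Subgroup SU3) (z : Fin 3 → ℂ) : Set (Fin 3 →₀ ℕ) :=
  {e | ∀ γ ∈ Γ, (γ : Matrix (Fin 3) (Fin 3) ℂ).mulVec z = z →
    ∏ i, (γ : Matrix (Fin 3) (Fin 3) ℂ) i i ^ e i = 1}

/-- If γ fixes z then f(γw + z) = f(γ(w + z)) = f(w + z), so the expansion at z is γ-invariant; a
diagonal γ rescales each coefficient separately. -/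
lemma mem_invariantExponents_of_coeff_ne_zero
    (hdiag : ∀ γ ∈ Γ, (γ : Matrix (Fin 3) (Fin 3) ℂ) =
      Matrix.diagonal fun i => (γ : Matrix (Fin 3) (Fin 3) ℂ) i i)
    {z : Fin 3 → ℂ} {f : MvPolynomial (Fin 3) ℂ}
    (hf : f ∈ invariantRing Γ) {e : Fin 3 →₀ ℕ}
    (he : MvPolynomial.coeff e (taylorAt z f) ≠ 0) : e ∈ invariantExponents Γ z := by
  intro γ hγ hz
  have h1 : linearSubst (γ : Matrix (Fin 3) (Fin 3) ℂ) (taylorAt z f) = taylorAt z f := by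
    apply MvPolynomial.funext
    intro w
    rw [eval_linearSubst, eval_taylorAt, eval_taylorAt, ← hf γ hγ (w + z), Matrix.mulVec_add, hz]
  have h2 := congrArg (MvPolynomial.coeff e) h1
  rw [hdiag γ hγ, coeff_linearSubst_diagonal] at h2
  exact mul_right_cancel₀ he (by rw [h2, one_mul])

lemma exists_invariant_coeff_taylorAt [Finite Γ]
    (hdiag : ∀ γ ∈ Γ, (γ : Matrix (Fin 3) (Fin 3) ℂ) =
      Matrix.diagonal fun i => (γ : Matrix (Fin 3) (Fin 3) ℂ) i i)
    (z : Fin 3 → ℂ) (P : MvPolynomial (Fin 3) ℂ)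
    (hP : ∀ e, MvPolynomial.coeff e P ≠ 0 → e ∈ invariantExponents Γ z) (N : ℕ) :
    ∃ F ∈ invariantRing Γ, ∀ e : Fin 3 →₀ ℕ, e.degree < N →
      MvPolynomial.coeff e (taylorAt z F) = MvPolynomial.coeff e P := by
  obtain ⟨F, hF, hFP⟩ := exists_invariant_sub_mem Γ z N (taylorAt (-z) P) (by
    intro γ hγ hz
    have h1 : linearSubst (γ : Matrix (Fin 3) (Fin 3) ℂ) P = P := by
      ext e
      rw [hdiag γ hγ, coeff_linearSubst_diagonal]
      by_cases he : MvPolynomial.coeff e P = 0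
      · simp [he]
      · rw [hP e he γ hγ hz, one_mul]
    apply MvPolynomial.funext
    intro w
    conv_rhs => rw [← h1]
    rw [eval_linearSubst, eval_taylorAt, eval_taylorAt, eval_linearSubst, Matrix.mulVec_add,
      Matrix.mulVec_neg, hz])
  refine ⟨F, hF, fun e he => ?_⟩
  have := coeff_taylorAt_eq_zero_of_mem_pow hFP e he
  rwa [map_sub, taylorAt_taylorAt_neg, MvPolynomial.coeff_sub, sub_eq_zero] at this

/-- A point is singular when its stabilizer has more than three indecomposable invariant
monomials. -/
theorem isSingular_of_indecomposable_exponents [Finite Γ]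
    (hdiag : ∀ γ ∈ Γ, (γ : Matrix (Fin 3) (Fin 3) ℂ) =
      Matrix.diagonal fun i => (γ : Matrix (Fin 3) (Fin 3) ℂ) i i)
    {n : ℕ} (hn : 0 < n)
    (hX : ∀ i, (MvPolynomial.X i : MvPolynomial (Fin 3) ℂ) ^ n ∈ invariantRing Γ)
    (z : Fin 3 → ℂ) {ι : Type*} [Fintype ι] (hι : 3 < Fintype.card ι)
    (μ : ι → Fin 3 →₀ ℕ) (hμ : Function.Injective μ) (hμ0 : ∀ j, μ j ≠ 0)
    (hμmem : ∀ j, μ j ∈ invariantExponents Γ z)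
    (hμirr : ∀ j, ∀ a ∈ invariantExponents Γ z, ∀ b ∈ invariantExponents Γ z,
      a + b = μ j → a = 0 ∨ b = 0) :
    (Orbifold.mk Γ z).IsSingular := by
  classical
  let D : invariantRing Γ →ₗ[ℂ] (ι → ℂ) := LinearMap.pi fun j =>
    (MvPolynomial.lcoeff ℂ (μ j)) ∘ₗ (taylorAt z).toLinearMap ∘ₗ
      (invariantRing Γ).val.toLinearMap
  have hDapp : ∀ f j, D f j =
      MvPolynomial.coeff (μ j) (taylorAt z (f : MvPolynomial (Fin 3) ℂ)) := fun f j => rfl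
  refine isSingular_of_derivations hn hX z hι D ?_ ?_
  · intro a b hb
    rw [mem_pointIdeal_mk, ← coeff_zero_taylorAt] at hb
    funext j
    rw [Pi.smul_apply, hDapp, hDapp, Subalgebra.coe_mul, map_mul, MvPolynomial.coeff_mul,
      Finset.sum_eq_single (0, μ j), coeff_zero_taylorAt, smul_eq_mul]
    -- Indecomposability leaves only u = 0 or v = 0, and v = 0 contributes nothing because b
    -- vanishes at z.
    · rintro ⟨u, v⟩ huv hne
      rw [Finset.HasAntidiagonal.mem_antidiagonal] at huv
      by_contra hprod
      obtain ⟨hu, hv⟩ := mul_ne_zero_iff.mp hprod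
      rcases hμirr j u (mem_invariantExponents_of_coeff_ne_zero hdiag a.2 hu) v
        (mem_invariantExponents_of_coeff_ne_zero hdiag b.2 hv) huv with h | h
      · subst h
        exact hne (by simpa using huv)
      · subst h
        exact hv hb
    · simp
  · intro v
    let P : MvPolynomial (Fin 3) ℂ := ∑ j, MvPolynomial.monomial (μ j) (v j)
    have hcoeff : ∀ e, MvPolynomial.coeff e P = ∑ j, if μ j = e then v j else 0 := by
      intro e
      simp [P, MvPolynomial.coeff_sum, MvPolynomial.coeff_monomial]
    obtain ⟨F, hF, hFP⟩ := exists_invariant_coeff_taylorAt hdiag z P (by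
      intro e he
      rw [hcoeff] at he
      obtain ⟨j, -, hj⟩ := Finset.exists_ne_zero_of_sum_ne_zero he
      by_cases h : μ j = e
      · exact h ▸ hμmem j
      -- The order is chosen to exceed the degree of every μ j.
      · simp [h] at hj) (∑ j, (μ j).degree + 1)
    refine ⟨⟨F, hF⟩, ?_, ?_⟩
    · rw [mem_pointIdeal_mk, ← coeff_zero_taylorAt, hFP 0 (by simp), hcoeff]
      simp [hμ0]
    · funext j
      rw [hDapp, hFP _ (Nat.lt_succ_of_le
        (Finset.single_le_sum (f := fun j => (μ j).degree) (fun _ _ => Nat.zero_le _)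
          (Finset.mem_univ j))), hcoeff]
      simp [hμ.eq_iff]

/-- A point with non-trivial stabilizer is singular. -/
theorem isSingular_of_stabilizer_nontrivial [Finite Γ]
    (hdiag : ∀ γ ∈ Γ, (γ : Matrix (Fin 3) (Fin 3) ℂ) =
      Matrix.diagonal fun i => (γ : Matrix (Fin 3) (Fin 3) ℂ) i i)
    {n : ℕ} (hn : 0 < n)
    (hX : ∀ i, (MvPolynomial.X i : MvPolynomial (Fin 3) ℂ) ^ n ∈ invariantRing Γ)
    (hpow : ∀ γ ∈ Γ, ∀ i, (γ : Matrix (Fin 3) (Fin 3) ℂ) i i ^ n = 1)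
    (z : Fin 3 → ℂ) {γ : SU3} (hγ : γ ∈ Γ) (hγ1 : γ ≠ 1)
    (hγz : (γ : Matrix (Fin 3) (Fin 3) ℂ).mulVec z = z) :
    (Orbifold.mk Γ z).IsSingular := by
  classical
  have hsingle : ∀ (i : Fin 3) (b : ℕ), Finsupp.single i b ∈ invariantExponents Γ z ↔
      ∀ δ ∈ Γ, (δ : Matrix (Fin 3) (Fin 3) ℂ).mulVec z = z →
        (δ : Matrix (Fin 3) (Fin 3) ℂ) i i ^ b = 1 := by
    intro i b
    have : ∀ δ : SU3, ∏ l, (δ : Matrix (Fin 3) (Fin 3) ℂ) l l ^ (Finsupp.single i b) l =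
        (δ : Matrix (Fin 3) (Fin 3) ℂ) i i ^ b := by
      intro δ
      rw [Finset.prod_eq_single i]
      · simp
      · intro l _ hl
        simp [hl]
      · simp
    simp only [invariantExponents, Set.mem_ofPred_eq, this]
  have hex : ∀ i : Fin 3, ∃ b, 0 < b ∧ Finsupp.single i b ∈ invariantExponents Γ z :=
    fun i => ⟨n, hn, (hsingle i n).mpr fun δ hδ _ => hpow δ hδ i⟩
  let a : Fin 3 → ℕ := fun i => Nat.find (hex i)
  have ha : ∀ i, 0 < a i ∧ Finsupp.single i (a i) ∈ invariantExponents Γ z :=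
    fun i => Nat.find_spec (hex i)
  have hamin : ∀ i b, 0 < b → Finsupp.single i b ∈ invariantExponents Γ z → a i ≤ b :=
    fun i b h1 h2 => Nat.find_min' (hex i) ⟨h1, h2⟩
  -- S is the set of coordinates moved by the stabilizer of z, and m the exponent of their product;
  -- m is invariant because determinants are 1.
  let S : Finset (Fin 3) := Finset.univ.filter fun i =>
    Finsupp.single i 1 ∉ invariantExponents Γ z
  let m : Fin 3 →₀ ℕ := Finsupp.indicator S fun _ _ => 1
  have hm : ∀ i, m i = if i ∈ S then 1 else 0 := by
    intro i
    simp [m, Finsupp.indicator_apply]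
  have hdet : ∀ δ ∈ Γ, ∏ i, (δ : Matrix (Fin 3) (Fin 3) ℂ) i i = 1 := by
    intro δ hδ
    have h1 := (Matrix.mem_specialUnitaryGroup_iff.mp δ.2).2
    rwa [hdiag δ hδ, Matrix.det_diagonal] at h1
  have hnotS : ∀ i ∉ S, ∀ δ ∈ Γ, (δ : Matrix (Fin 3) (Fin 3) ℂ).mulVec z = z →
      (δ : Matrix (Fin 3) (Fin 3) ℂ) i i = 1 := by
    intro i hi δ hδ hδz
    have : Finsupp.single i 1 ∈ invariantExponents Γ z := by simpa [S] using hi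
    simpa using (hsingle i 1).mp this δ hδ hδz
  have hmmem : m ∈ invariantExponents Γ z := by
    intro δ hδ hδz
    rw [← hdet δ hδ]
    refine Finset.prod_congr rfl fun i _ => ?_
    by_cases hi : i ∈ S
    · simp [hm, hi]
    · rw [hnotS i hi δ hδ hδz, one_pow]
  have hScard : 2 ≤ S.card := by
    obtain ⟨i, hi⟩ : ∃ i, (γ : Matrix (Fin 3) (Fin 3) ℂ) i i ≠ 1 := by
      by_contra! h
      apply hγ1
      apply Subtype.ext
      rw [hdiag γ hγ]
      simp [h]
    by_contra! hlt
    have hiS : i ∈ S := by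
      by_contra h
      exact hi (hnotS i h γ hγ hγz)
    have hS1 : ∀ j ∈ S, j = i := fun j hj =>
      Finset.card_le_one.mp (Nat.lt_succ_iff.mp hlt) j hj i hiS
    apply hi
    rw [← hdet γ hγ, Finset.prod_eq_single i]
    · intro j _ hji
      exact hnotS j (fun hj => hji (hS1 j hj)) γ hγ hγz
    · simp
  have hne : ∀ i, m ≠ Finsupp.single i (a i) := by
    intro i h
    obtain ⟨j, hj, hji⟩ := Finset.exists_mem_ne hScard i
    have := hm j
    rw [h, if_pos hj, Finsupp.single_eq_of_ne hji] at this
    exact zero_ne_one this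
  -- Four exponents: `none` stands for m, `some i` for the least invariant power of the i-th
  -- coordinate.
  refine isSingular_of_indecomposable_exponents hdiag hn hX z (ι := Option (Fin 3)) (by simp)
    (fun j => j.elim m fun i => Finsupp.single i (a i)) ?_ ?_ ?_ ?_
  · rintro (_ | i) (_ | j) h
    · rfl
    · exact absurd h (hne j)
    · exact absurd h.symm (hne i)
    · rcases Finsupp.single_eq_single_iff _ _ _ _ |>.mp h with h | h
      · rw [h.1]
      · exact absurd h.1 (ha i).1.ne'
  · rintro (_ | i)
    · obtain ⟨j, hj⟩ := Finset.card_pos.mp (by omega : 0 < S.card)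
      intro h
      have := hm j
      rw [if_pos hj] at this
      exact zero_ne_one ((DFunLike.congr_fun h j).symm.trans this)
    · simpa using (ha i).1.ne'
  · rintro (_ | i)
    · exact hmmem
    · exact (ha i).2
  -- No invariant of degree 1 divides m, while m has degree at most 3, so any proper splitting would
  -- have a part of degree 1.
  · have hmirr : ∀ u ∈ invariantExponents Γ z, ∀ v, u + v = m → u.degree ≠ 1 := by
      intro u hu v huv hdeg
      obtain ⟨i, rfl⟩ : u ∈ Set.range fun i : Fin 3 => Finsupp.single i 1 := by
        rw [Finsupp.range_single_one]
        exact hdeg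
      have h1 := hm i
      rw [← huv] at h1
      have hiS : i ∉ S := by simpa [S] using hu
      simp [hiS] at h1
    rintro (_ | i) u hu v hv huv
    · by_contra! h
      have h1 : u.degree + v.degree ≤ 3 := by
        rw [← map_add, huv, Option.elim_none, Finsupp.degree_eq_sum]
        simp only [hm, Finset.sum_boole, Nat.cast_id]
        exact (Finset.card_le_univ _).trans (by simp)
      have h2 := hmirr u hu v huv
      have h3 := hmirr v hv u (by rw [add_comm]; exact huv)
      have h4 := (Finsupp.degree_eq_zero_iff u).not.mpr h.1
      have h5 := (Finsupp.degree_eq_zero_iff v).not.mpr h.2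
      omega
    · rw [Option.elim_some] at huv
      have key : ∀ j ≠ i, u j = 0 ∧ v j = 0 := by
        intro j hj
        have := DFunLike.congr_fun huv j
        rw [Finsupp.add_apply, Finsupp.single_eq_of_ne hj] at this
        omega
      have hu' : u = Finsupp.single i (u i) := by
        ext j
        by_cases hj : j = i
        · simp [hj]
        · simp [(key j hj).1, hj]
      have hv' : v = Finsupp.single i (v i) := by
        ext j
        by_cases hj : j = i
        · simp [hj]
        · simp [(key j hj).2, hj]
      have hsum := DFunLike.congr_fun huv i
      rw [Finsupp.add_apply, Finsupp.single_eq_same] at hsum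
      by_contra! h
      have h1 : 0 < u i := by
        rw [Nat.pos_iff_ne_zero]
        intro h0
        rw [h0, Finsupp.single_zero] at hu'
        exact h.1 hu'
      have h2 : 0 < v i := by
        rw [Nat.pos_iff_ne_zero]
        intro h0
        rw [h0, Finsupp.single_zero] at hv'
        exact h.2 hv'
      have h3 := hamin i (u i) h1 (hu' ▸ hu)
      omega

end Diagonal

/-! ### Stabilizers in the cyclic group -/

section Cyclic

variable {k : ℕ} {α : Fin 3 → ℤ} {ω : SU3}

lemma coe_pow_eq_diagonal (hω : (ω : Matrix (Fin 3) (Fin 3) ℂ) = diagonalWeight k α) (j : ℕ) :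
    ((ω ^ j : SU3) : Matrix (Fin 3) (Fin 3) ℂ) = Matrix.diagonal fun i =>
      Complex.exp (2 * Real.pi * Complex.I / k) ^ (α i * (j : ℤ)) := by
  rw [SubmonoidClass.coe_pow, hω, diagonalWeight, Matrix.diagonal_pow]
  congr 1
  funext i
  rw [Pi.pow_apply, zpow_mul, zpow_natCast]

lemma exp_zpow_eq_one_iff (hk : 0 < k) (a : ℤ) :
    Complex.exp (2 * Real.pi * Complex.I / k) ^ a = 1 ↔ (k : ℤ) ∣ a :=
  (Complex.isPrimitiveRoot_exp k hk.ne').zpow_eq_one_iff_dvd a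

lemma exists_pow_of_mem_zpowers (hk : 0 < k) (hord : orderOf ω = k) {γ : SU3}
    (hγ : γ ∈ Subgroup.zpowers ω) : ∃ j : ℕ, ω ^ j = γ := by
  have h : IsOfFinOrder ω := orderOf_pos_iff.mp (hord ▸ hk)
  exact h.mem_powers_iff_mem_zpowers.mpr hγ

lemma isSingular_iff_exists_stabilizer (hk : 0 < k)
    (hω : (ω : Matrix (Fin 3) (Fin 3) ℂ) = diagonalWeight k α) (hord : orderOf ω = k)
    (z : Fin 3 → ℂ) :
    (Orbifold.mk (Subgroup.zpowers ω) z).IsSingular ↔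
      ∃ γ ∈ Subgroup.zpowers ω, γ ≠ 1 ∧ (γ : Matrix (Fin 3) (Fin 3) ℂ).mulVec z = z := by
  have hfin : Finite (Subgroup.zpowers ω) :=
    (orderOf_pos_iff.mp (hord ▸ hk) : IsOfFinOrder ω).finite_zpowers
  have hpow : ∀ γ ∈ Subgroup.zpowers ω, ∀ i,
      (γ : Matrix (Fin 3) (Fin 3) ℂ) i i ^ k = 1 := by
    intro γ hγ i
    obtain ⟨j, rfl⟩ := exists_pow_of_mem_zpowers hk hord hγ
    rw [coe_pow_eq_diagonal hω, Matrix.diagonal_apply_eq, ← zpow_natCast, ← zpow_mul,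
      exp_zpow_eq_one_iff hk]
    exact Dvd.intro_left _ rfl
  have hdiag : ∀ γ ∈ Subgroup.zpowers ω, (γ : Matrix (Fin 3) (Fin 3) ℂ) =
      Matrix.diagonal fun i => (γ : Matrix (Fin 3) (Fin 3) ℂ) i i := by
    intro γ hγ
    obtain ⟨j, rfl⟩ := exists_pow_of_mem_zpowers hk hord hγ
    simp [coe_pow_eq_diagonal hω]
  have hX : ∀ i, (MvPolynomial.X i : MvPolynomial (Fin 3) ℂ) ^ k ∈
      invariantRing (Subgroup.zpowers ω) := by
    intro i γ hγ z
    rw [hdiag γ hγ]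
    simp [Matrix.mulVec_diagonal, mul_pow, hpow γ hγ i]
  constructor
  · contrapose!
    intro h
    exact not_isSingular_of_stabilizer_trivial hk hX z fun γ hγ hz => by
      by_contra h1
      exact h γ hγ h1 hz
  · rintro ⟨γ, hγ, h1, hz⟩
    exact isSingular_of_stabilizer_nontrivial hdiag hk hX hpow z hγ h1 hz

lemma eq_zero_of_mulVec_eq_self (hk : 0 < k)
    (hω : (ω : Matrix (Fin 3) (Fin 3) ℂ) = diagonalWeight k α) (hord : orderOf ω = k)
    (hα : ∀ i, Int.gcd (k : ℤ) (α i) = 1) {γ : SU3} (hγ : γ ∈ Subgroup.zpowers ω) (h1 : γ ≠ 1)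
    {z : Fin 3 → ℂ} (hz : (γ : Matrix (Fin 3) (Fin 3) ℂ).mulVec z = z) : z = 0 := by
  obtain ⟨j, rfl⟩ := exists_pow_of_mem_zpowers hk hord hγ
  funext i
  by_contra hzi
  have h2 := congrFun hz i
  rw [coe_pow_eq_diagonal hω, Matrix.mulVec_diagonal] at h2
  have h3 := (exp_zpow_eq_one_iff hk _).mp (mul_right_cancel₀ hzi (h2.trans (one_mul _).symm))
  have h4 : (k : ℤ) ∣ j := Int.dvd_of_dvd_mul_right_of_gcd_one h3 (hα i)
  apply h1
  rw [← orderOf_dvd_iff_pow_eq_one, hord]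
  exact_mod_cast h4

/-- The element is ω^(k/d) with d = gcd(k, α_i) ≥ 2: its exponent lies strictly between 0 and k, and
k divides α_i k/d. -/
lemma exists_mulVec_single_eq_self (hk : 0 < k)
    (hω : (ω : Matrix (Fin 3) (Fin 3) ℂ) = diagonalWeight k α) (hord : orderOf ω = k)
    {i : Fin 3} (hα : Int.gcd (k : ℤ) (α i) ≠ 1) :
    ∃ γ ∈ Subgroup.zpowers ω, γ ≠ 1 ∧ ∀ c : ℂ,
      (γ : Matrix (Fin 3) (Fin 3) ℂ).mulVec (Pi.single i c) = Pi.single i c := by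
  obtain ⟨j, hj⟩ : Int.gcd (k : ℤ) (α i) ∣ k := by
    exact_mod_cast Int.gcd_dvd_left (k : ℤ) (α i)
  obtain ⟨t, ht⟩ := Int.gcd_dvd_right (k : ℤ) (α i)
  set d := Int.gcd (k : ℤ) (α i) with hd
  have hdj : 0 < d * j := hj ▸ hk
  have hj0 : 0 < j := Nat.pos_of_mul_pos_left hdj
  have hd0 : 0 < d := Nat.pos_of_mul_pos_right hdj
  refine ⟨ω ^ j, Subgroup.npow_mem_zpowers ω j, ?_, fun c => ?_⟩
  · intro h
    have h1 := Nat.le_of_dvd hj0 (orderOf_dvd_of_pow_eq_one h)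
    rw [hord] at h1
    have : 2 * j ≤ d * j := Nat.mul_le_mul_right j (by omega)
    omega
  · have h1 : Complex.exp (2 * Real.pi * Complex.I / k) ^ (α i * (j : ℤ)) = 1 := by
      rw [exp_zpow_eq_one_iff hk]
      refine ⟨t, ?_⟩
      have : (k : ℤ) = d * j := by exact_mod_cast hj
      rw [this, ht]
      ring
    rw [coe_pow_eq_diagonal hω]
    funext l
    rw [Matrix.mulVec_diagonal]
    by_cases hl : l = i
    · subst hl
      rw [h1, one_mul]
    · simp [hl]

/-- A neighbourhood of a point of the axis contains the images of infinitely many axis points, but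
the orbit of c e_i is finite. -/
lemma not_isIsolatedSingularity_single {Γ : Subgroup SU3} [Finite Γ] (i : Fin 3)
    (hs : ∀ c : ℂ, (Orbifold.mk Γ (Pi.single i c)).IsSingular) (c : ℂ) :
    ¬ (Orbifold.mk Γ (Pi.single i c)).IsIsolatedSingularity := by
  rintro ⟨-, U, hU, hc, hiso⟩
  have hcont : Continuous fun x : ℂ => Orbifold.mk Γ (Pi.single i x) :=
    (continuous_quotient_mk' (s := orbitSetoid Γ)).comp (continuous_single (A := fun _ : Fin 3 => ℂ) i)
  have hinf : ((fun x : ℂ => Orbifold.mk Γ (Pi.single i x)) ⁻¹' U).Infinite :=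
    infinite_of_mem_nhds c ((hU.preimage hcont).mem_nhds hc)
  refine hinf ((Set.finite_range fun γ : Γ =>
    (γ : Matrix (Fin 3) (Fin 3) ℂ).mulVec (Pi.single i c) i).subset fun x hx => ?_)
  obtain ⟨γ, hγ, h⟩ := Orbifold.mk_eq_mk_iff.mp (hiso _ hx (hs x)).symm
  exact ⟨⟨γ, hγ⟩, by simpa using congrFun h i⟩

lemma dvd_sum_weights (hk : 0 < k)
    (hω : (ω : Matrix (Fin 3) (Fin 3) ℂ) = diagonalWeight k α) : (k : ℤ) ∣ ∑ i, α i := by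
  have h := (Matrix.mem_specialUnitaryGroup_iff.mp ω.2).2
  rw [hω, diagonalWeight, Matrix.det_diagonal] at h
  rw [← exp_zpow_eq_one_iff hk, ← h, Fin.sum_univ_three, Fin.prod_univ_three,
    zpow_add₀ (Complex.exp_ne_zero _), zpow_add₀ (Complex.exp_ne_zero _)]

end Cyclic

/-! ### The main theorem -/

theorem mainTheorem2 (k : ℕ) (hk : 0 < k) (α : Fin 3 → ℤ) (ω : SU3)
    (hω : (ω : Matrix (Fin 3) (Fin 3) ℂ) = diagonalWeight k α) (hord : orderOf ω = k) :
    (HasOnlyIsolatedSingularities (Subgroup.zpowers ω) ↔ ∀ i, Int.gcd (k : ℤ) (α i) = 1) ∧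
    (2 ≤ k →
      ({p : Orbifold (Subgroup.zpowers ω) | p.IsSingular} =
          {Orbifold.mk (Subgroup.zpowers ω) 0} ↔
        ∀ i, Int.gcd (k : ℤ) (α i) = 1)) ∧
    (Even k →
      ¬ HasOnlyIsolatedSingularities (Subgroup.zpowers ω) ∧
      ∃ i, Even (α i) ∧
        (∃ γ ∈ Subgroup.zpowers ω, γ ≠ 1 ∧ ∀ c : ℂ,
          (γ : Matrix (Fin 3) (Fin 3) ℂ).mulVec (Pi.single i c) = Pi.single i c) ∧
        ∀ c : ℂ,
          (Orbifold.mk (Subgroup.zpowers ω) (Pi.single i c)).IsSingular ∧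
          ¬ (Orbifold.mk (Subgroup.zpowers ω) (Pi.single i c)).IsIsolatedSingularity) := by
  have hfin : Finite (Subgroup.zpowers ω) :=
    (orderOf_pos_iff.mp (hord ▸ hk) : IsOfFinOrder ω).finite_zpowers
  have haxis : ∀ i, Int.gcd (k : ℤ) (α i) ≠ 1 → ∀ c : ℂ,
      (Orbifold.mk (Subgroup.zpowers ω) (Pi.single i c)).IsSingular ∧
      ¬ (Orbifold.mk (Subgroup.zpowers ω) (Pi.single i c)).IsIsolatedSingularity := by
    intro i hi
    obtain ⟨γ, hγ, hγ1, hfix⟩ := exists_mulVec_single_eq_self hk hω hord hi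
    have hs : ∀ c : ℂ, (Orbifold.mk (Subgroup.zpowers ω) (Pi.single i c)).IsSingular :=
      fun c => (isSingular_iff_exists_stabilizer hk hω hord _).mpr ⟨γ, hγ, hγ1, hfix c⟩
    exact fun c => ⟨hs c, not_isIsolatedSingularity_single i hs c⟩
  have horigin : (∀ i, Int.gcd (k : ℤ) (α i) = 1) → ∀ p : Orbifold (Subgroup.zpowers ω),
      p.IsSingular → p = Orbifold.mk (Subgroup.zpowers ω) 0 := by
    intro hα p hp
    obtain ⟨z, rfl⟩ : ∃ z, Orbifold.mk (Subgroup.zpowers ω) z = p := Quotient.exists_rep p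
    obtain ⟨γ, hγ, hγ1, hz⟩ := (isSingular_iff_exists_stabilizer hk hω hord z).mp hp
    rw [eq_zero_of_mulVec_eq_self hk hω hord hα hγ hγ1 hz]
  have hiff : HasOnlyIsolatedSingularities (Subgroup.zpowers ω) ↔
      ∀ i, Int.gcd (k : ℤ) (α i) = 1 := by
    constructor
    · intro h i
      by_contra hi
      obtain ⟨h1, h2⟩ := haxis i hi 0
      exact h2 (h _ h1)
    · intro hα p hp
      exact ⟨hp, Set.univ, isOpen_univ, trivial,
        fun q _ hq => (horigin hα q hq).trans (horigin hα p hp).symm⟩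
  refine ⟨hiff, fun hk2 => ?_, fun heven => ?_⟩
  · constructor
    · intro h
      -- A unique singular point is isolated, so the first equivalence applies.
      refine hiff.mp fun p hp => ⟨hp, Set.univ, isOpen_univ, trivial, fun q _ hq => ?_⟩
      have hp' : p ∈ ({Orbifold.mk (Subgroup.zpowers ω) 0} : Set _) := h ▸ hp
      have hq' : q ∈ ({Orbifold.mk (Subgroup.zpowers ω) 0} : Set _) := h ▸ hq
      exact Eq.trans hq' (Eq.symm hp')
    · intro hα
      refine Set.Subset.antisymm (horigin hα) (Set.singleton_subset_iff.mpr ?_)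
      -- The generator fixes the origin, and k ≥ 2 makes it non-trivial.
      refine (isSingular_iff_exists_stabilizer hk hω hord 0).mpr
        ⟨ω, Subgroup.mem_zpowers ω, fun h => ?_, Matrix.mulVec_zero _⟩
      rw [h, orderOf_one] at hord
      omega
  · obtain ⟨i, hi⟩ : ∃ i, Even (α i) := by
      have h2 : (2 : ℤ) ∣ ∑ i, α i :=
        dvd_trans (by exact_mod_cast heven.two_dvd) (dvd_sum_weights hk hω)
      by_contra! h
      rw [Fin.sum_univ_three, ← even_iff_two_dvd] at h2
      exact Int.not_even_iff_odd.mpr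
        (((Int.not_even_iff_odd.mp (h 0)).add_odd (Int.not_even_iff_odd.mp (h 1))).add_odd
          (Int.not_even_iff_odd.mp (h 2))) h2
    have hgcd : Int.gcd (k : ℤ) (α i) ≠ 1 := by
      intro h
      have h2 : ((2 : ℕ) : ℤ) ∣ (Int.gcd (k : ℤ) (α i) : ℤ) :=
        Int.dvd_coe_gcd (by exact_mod_cast heven.two_dvd) (by exact_mod_cast hi.two_dvd)
      rw [h] at h2
      norm_num at h2
    exact ⟨fun h => hgcd (hiff.mp h i), i, hi, exists_mulVec_single_eq_self hk hω hord hgcd,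
      haxis i hgcd⟩
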